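/- Let $n \ge 2$ be an integer. For a finite field $\mathbb{F}_q$ of $q$ elements, let $\mathcal{M}_n(\mathbb{F}_q)$ be the set of all $n\times n$ matrices over $\mathbb{F}_q$ and $\mathrm{GL}_n(\mathbb{F}_q)$ the group of invertible ones. For sets $\mathcal{A},\mathcal{B},\mathcal{C},\mathcal{D}\subseteq \mathcal{M}_n(\mathbb{F}_q)$ and $H\in \mathrm{GL}_n(\mathbb{F}_q)$, let $R(\mathcal{A},\mathcal{B},\mathcal{C},\mathcal{D};H)$ be the number of quadruples $(A,B,C,D)\in\mathcal{A}\times\mathcal{B}\times\mathcal{C}\times\mathcal{D}$ with $H=(A+B)(C+D)$. Then: (i) There is a constant $K(n)>0$, depending only on $n$, such that for every finite field $\mathbb{F}_q$, all sets $\mathcal{A},\mathcal{B},\mathcal{C},\mathcal{D}\subseteq \mathcal{M}_n(\mathbb{F}_q)$ and every $H\in \mathrm{GL}_n(\mathbb{F}_q)$, $$\left| R(\mathcal{A},\mathcal{B},\mathcal{C},\mathcal{D};H) - \frac{\#\mathcal{A}\,\#\mathcal{B}\,\#\mathcal{C}\,\#\mathcal{D}}{q^{n^2}} \right| \le K(n)\,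 q^{n^2-1/2}\sqrt{\#\mathcal{A}\,\#\mathcal{B}\,\#\mathcal{C}\,\#\mathcal{D}}.$$ (ii) There is a constant $c(n)>0$, depending only on $n$, such that for every finite field $\mathbb{F}_q$ and all sets $\mathcal{A},\mathcal{B},\mathcal{C},\mathcal{D}\subseteq \mathcal{M}_n(\mathbb{F}_q)$ with $\#\mathcal{A}\,\#\mathcal{B}\,\#\mathcal{C}\,\#\mathcal{D}\ge c(n)\,q^{4n^2-1}$, every $H\in\mathrm{GL}_n(\mathbb{F}_q)$ can be written as $H=(A+B)(C+D)$ with $A\in\mathcal{A}$, $B\in\mathcal{B}$, $C\in\mathcal{C}$, $D\in\mathcal{D}$. -/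

import Mathlib

/-- The number `R(A, B, C, D; H)` of solutions of the matrix equation `H = (a + b)(c + d)`
with `a ∈ A`, `b ∈ B`, `c ∈ C`, `d ∈ D`, where `A, B, C, D` are sets of `n × n` matrices
over `F`: the number of quadruples `(a, b, c, d)` in `A × B × C × D` with that property. -/
def sumProdCount {n : ℕ} {F : Type*} [Field F] [DecidableEq F]
    (A B C D : Finset (Matrix (Fin n) (Fin n) F)) (H : Matrix (Fin n) (Fin n) F) : ℕ :=
  ((A ×ˢ B ×ˢ C ×ˢ D).filter
    (fun x => H = (x.1 + x.2.1) * (x.2.2.1 + x.2.2.2))).card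

/-! Write q = #F and Q = q^(n²). Since H is invertible, H = (a+b)(c+d) holds iff a+b = X and c+d =
X⁻¹H for a unique invertible X. Detecting both equations by additive characters
(`card_mul_card_mul_count_eq`) gives Q²·R as a sum over (U, V) of Fourier transforms of the four
sets, weighted by matrix Kloosterman sums at (-U, -HV). The pair (0, 0) contributes the main term up
to the density O(n/q) of singular matrices; every other weight is at most 5Q/q, and Cauchy–Schwarz
with Parseval sums the rest.

The Kloosterman bound is elementary. For N² = 0, replacing X by X(1+tN) replaces X⁻¹ by (1-tN)X⁻¹,
so the phase is affine in t. Averaging over t keeps only those X on one trace equation, and scaling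
X shows that these have density O(1/q). A suitable N exists because n ≥ 2. -/

section

open Matrix

/-- If, along a family of permutations of `α`, every orbit meets `P` at most `k` times,
then `P` has density at most `k / #T`. -/
theorem card_mul_card_filter_le_of_perm {α T : Type*} [Fintype α] [Fintype T]
    (σ : T → Equiv.Perm α) (P : α → Prop) [DecidablePred P] (k : ℕ)
    (h : ∀ x, (Finset.univ.filter fun t => P (σ t x)).card ≤ k) :
    Fintype.card T * (Finset.univ.filter P).card ≤ k * Fintype.card α := by
  classical
  have h1 : ∀ t : T, (Finset.univ.filter P).card
      = ∑ x, if P (σ t x) then 1 else 0 := by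
    intro t
    rw [Finset.card_filter]
    exact (Equiv.sum_comp (σ t) fun x => if P x then 1 else 0).symm
  calc Fintype.card T * (Finset.univ.filter P).card
      = ∑ _t : T, (Finset.univ.filter P).card := by simp
    _ = ∑ t : T, ∑ x, (if P (σ t x) then 1 else 0) := Finset.sum_congr rfl fun t _ => h1 t
    _ = ∑ x, (Finset.univ.filter fun t => P (σ t x)).card := by
        rw [Finset.sum_comm]; simp only [Finset.card_filter]
    _ ≤ ∑ _x : α, k := Finset.sum_le_sum fun x _ => h x
    _ = k * Fintype.card α := by simp [mul_comm]

/-! ### Trace characters and the density of trace and determinant conditions. -/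

section Trace

variable {F ι : Type*} [Field F] [Fintype ι]

theorem exists_trace_mul_eq [DecidableEq ι] {X : Matrix ι ι F} (hX : X ≠ 0) (t : F) :
    ∃ U : Matrix ι ι F, (U * X).trace = t := by
  obtain ⟨i, j, hij⟩ : ∃ i j, X i j ≠ 0 := by
    by_contra! h
    exact hX (Matrix.ext h)
  exact ⟨Matrix.single j i (t / X i j), by simp [Matrix.trace_single_mul, hij]⟩

theorem sum_addChar_trace_mul [DecidableEq ι] [Fintype F] [DecidableEq F] {ψ : AddChar F ℂ} (hψ : ψ ≠ 1)
    (X : Matrix ι ι F) :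
    ∑ U : Matrix ι ι F, ψ (U * X).trace
      = if X = 0 then (Fintype.card (Matrix ι ι F) : ℂ) else 0 := by
  split_ifs with hX
  · simp [hX]
  · let φ : AddChar (Matrix ι ι F) ℂ := ψ.compAddMonoidHom
      ((Matrix.traceAddMonoidHom ι F).comp (AddMonoidHom.mulRight X))
    have hφ : φ ≠ 1 := by
      obtain ⟨t, ht⟩ := AddChar.ne_one_iff.1 hψ
      obtain ⟨U, hU⟩ := exists_trace_mul_eq hX t
      refine AddChar.ne_one_iff.2 ⟨U, ?_⟩
      simpa [φ, hU] using ht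
    simpa [φ] using AddChar.sum_eq_zero_of_ne_one hφ

variable [DecidableEq ι] [Fintype F] [DecidableEq F]

theorem card_mul_card_trace_mul_eq_zero_le {W : Matrix ι ι F} (hW : W ≠ 0) :
    Fintype.card F * (Finset.univ.filter fun X : Matrix ι ι F => (X * W).trace = 0).card
      ≤ Fintype.card (Matrix ι ι F) := by
  obtain ⟨E, hE⟩ := exists_trace_mul_eq hW 1
  have := card_mul_card_filter_le_of_perm (fun t : F => Equiv.addRight (t • E))
    (fun X : Matrix ι ι F => (X * W).trace = 0) 1 (fun X => by
      refine Finset.card_le_one.2 fun s hs t ht => ?_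
      simp only [Finset.mem_filter, Finset.mem_univ, true_and, Equiv.coe_addRight, add_mul,
        Matrix.trace_add, Matrix.smul_mul, Matrix.trace_smul, hE, smul_eq_mul, mul_one] at hs ht
      linear_combination hs - ht)
  simpa using this

/-- On each line t ↦ t·1 - X the determinant is the characteristic polynomial of X, with at most n
roots. -/
theorem card_mul_card_det_eq_zero_le :
    Fintype.card F * (Finset.univ.filter fun X : Matrix ι ι F => X.det = 0).card
      ≤ Fintype.card ι * Fintype.card (Matrix ι ι F) := by
  refine card_mul_card_filter_le_of_perm (fun t : F => Equiv.subLeft (Matrix.scalar ι t))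
    (fun X : Matrix ι ι F => X.det = 0) _ fun X => ?_
  calc (Finset.univ.filter fun t : F => (Equiv.subLeft (Matrix.scalar ι t) X).det = 0).card
      ≤ X.charpoly.roots.toFinset.card := by
        refine Finset.card_le_card fun t ht => ?_
        simp only [Finset.mem_filter, Finset.mem_univ, true_and, Equiv.subLeft_apply] at ht
        rw [Multiset.mem_toFinset, Polynomial.mem_roots X.charpoly_monic.ne_zero,
          Polynomial.IsRoot.def, Matrix.eval_charpoly, ht]
    _ ≤ X.charpoly.roots.card := Multiset.toFinset_card_le _
    _ ≤ X.charpoly.natDegree := Polynomial.card_roots' _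
    _ = Fintype.card ι := X.charpoly_natDegree_eq_dim

theorem card_GL_add_card_det_eq_zero :
    Fintype.card (GL ι F) + (Finset.univ.filter fun X : Matrix ι ι F => X.det = 0).card
      = Fintype.card (Matrix ι ι F) := by
  have h : Fintype.card (GL ι F) = (Finset.univ.filter fun X : Matrix ι ι F => ¬ X.det = 0).card := by
    rw [← Finset.card_univ]
    refine Finset.card_bij (fun X _ => (X : Matrix ι ι F)) (fun X _ => ?_)
      (fun X _ Y _ h => Units.ext h) fun X hX => ?_
    · simpa using ((Matrix.isUnit_iff_isUnit_det _).1 X.isUnit).ne_zero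
    · have : IsUnit X := (Matrix.isUnit_iff_isUnit_det _).2 (isUnit_iff_ne_zero.2 (by simpa using hX))
      exact ⟨this.unit, Finset.mem_univ _, rfl⟩
  rw [h, add_comm, Finset.card_filter_add_card_filter_not, Finset.card_univ]

theorem card_GL_le : Fintype.card (GL ι F) ≤ Fintype.card (Matrix ι ι F) :=
  card_GL_add_card_det_eq_zero (F := F) (ι := ι) ▸ Nat.le_add_right _ _

/-- The scaling `X ↦ t X` turns `tr (X W) = tr (Z X⁻¹)` into a quadratic condition on `t`. -/
theorem card_units_mul_card_trace_eq_le (W Z : Matrix ι ι F) :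
    Fintype.card Fˣ * (Finset.univ.filter fun X : GL ι F =>
        (X.1 * W).trace = (Z * X⁻¹.1).trace ∧ (X.1 * W).trace ≠ 0).card
      ≤ 2 * Fintype.card (GL ι F) := by
  refine card_mul_card_filter_le_of_perm (fun t : Fˣ => (MulAction.toPerm t : Equiv.Perm (GL ι F)))
    _ 2 fun X => ?_
  have key : ∀ t : Fˣ, (((t • X).1 * W).trace = (Z * (t • X)⁻¹.1).trace ∧ ((t • X).1 * W).trace ≠ 0) →
      (X.1 * W).trace ≠ 0 ∧ (t : F) ^ 2 * (X.1 * W).trace = (Z * X⁻¹.1).trace := by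
    rintro t ⟨h1, h2⟩
    have hinv : (t • X)⁻¹.1 = ((t⁻¹ : Fˣ) : F) • X⁻¹.1 := rfl
    rw [hinv, Units.val_smul, Units.smul_def, Matrix.smul_mul,
      Matrix.mul_smul, Matrix.trace_smul, Matrix.trace_smul, smul_eq_mul, smul_eq_mul] at h1
    rw [Units.val_smul, Units.smul_def, Matrix.smul_mul, Matrix.trace_smul, smul_eq_mul] at h2
    refine ⟨right_ne_zero_of_mul h2, ?_⟩
    have h3 : (t : F) * ((t⁻¹ : Fˣ) : F) = 1 := Units.mul_inv t
    linear_combination (t : F) * h1 + (Z * X⁻¹.1).trace * h3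
  rcases Finset.eq_empty_or_nonempty (Finset.univ.filter fun t : Fˣ =>
      ((t • X).1 * W).trace = (Z * (t • X)⁻¹.1).trace ∧ ((t • X).1 * W).trace ≠ 0) with he | ⟨s, hs⟩
  · exact (Finset.card_eq_zero.2 he).le.trans (Nat.zero_le _)
  · refine (Finset.card_le_card (t := {s, -s}) fun t ht => ?_).trans Finset.card_le_two
    have h1 := key s (Finset.mem_filter.1 hs).2
    have h2 := key t (Finset.mem_filter.1 ht).2
    have h3 : (t : F) ^ 2 = (s : F) ^ 2 := mul_right_cancel₀ h1.1 (h2.2.trans h1.2.symm)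
    rcases sq_eq_sq_iff_eq_or_eq_neg.1 h3 with h | h
    · simp [Units.ext h]
    · have : t = -s := Units.ext (by simpa using h)
      simp [this]

theorem card_mul_card_trace_eq_le {W : Matrix ι ι F} (hW : W ≠ 0) (Z : Matrix ι ι F) :
    Fintype.card F * (Finset.univ.filter fun X : GL ι F =>
        (X.1 * W).trace = (Z * X⁻¹.1).trace).card
      ≤ 5 * Fintype.card (Matrix ι ι F) := by
  set a := (Finset.univ.filter fun X : GL ι F =>
        (X.1 * W).trace = (Z * X⁻¹.1).trace ∧ (X.1 * W).trace ≠ 0).card with ha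
  set b := (Finset.univ.filter fun X : Matrix ι ι F => (X * W).trace = 0).card with hb
  have h1 : (Finset.univ.filter fun X : GL ι F => (X.1 * W).trace = (Z * X⁻¹.1).trace).card
      ≤ a + b := by
    have hsub : (Finset.univ.filter fun X : GL ι F => (X.1 * W).trace = 0).card ≤ b :=
      Finset.card_le_card_of_injOn (fun X => X.1) (fun X hX => by simpa using hX)
        fun X _ Y _ h => Units.ext h
    refine le_trans (Finset.card_le_card fun X hX => ?_)
      ((Finset.card_union_le _ _).trans (Nat.add_le_add_left hsub a))
    simp only [Finset.mem_union, Finset.mem_filter, Finset.mem_univ, true_and] at hX ⊢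
    by_cases h : (X.1 * W).trace = 0
    · exact Or.inr h
    · exact Or.inl ⟨hX, h⟩
  have h2 := card_units_mul_card_trace_eq_le W Z
  have h3 := card_mul_card_trace_mul_eq_zero_le hW
  have h4 := card_GL_le (F := F) (ι := ι)
  have h5 : Fintype.card F ≤ 2 * Fintype.card Fˣ := by
    rw [Fintype.card_units]
    have := Fintype.one_lt_card (α := F)
    omega
  rw [← ha] at h2
  rw [← hb] at h3
  -- The constant is 5 = 4 + 1: q ≤ 2(q - 1) turns the bound for `a` into q·a ≤ 4Q, and the
  -- hyperplane gives q·b ≤ Q.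
  nlinarith [Nat.mul_le_mul_left (Fintype.card F) h1, Nat.mul_le_mul_right a h5]

end Trace

/-! ### Bounds for matrix Kloosterman sums. -/

section Kloosterman

variable {F ι : Type*} [Field F] [Fintype F] [DecidableEq F] [Fintype ι] [DecidableEq ι]

/-- The matrix Kloosterman sum `∑ ψ (tr (U X) + tr (V X⁻¹))` over invertible `X`. -/
noncomputable def matrixKloosterman (ψ : AddChar F ℂ) (U V : Matrix ι ι F) : ℂ :=
  ∑ X : GL ι F, ψ ((U * X.1).trace + (V * X⁻¹.1).trace)

theorem matrixKloosterman_comm (ψ : AddChar F ℂ) (U V : Matrix ι ι F) :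
    matrixKloosterman ψ U V = matrixKloosterman ψ V U := by
  unfold matrixKloosterman
  rw [← Equiv.sum_comp (Equiv.inv (GL ι F))]
  refine Finset.sum_congr rfl fun X _ => ?_
  rw [Equiv.inv_apply, inv_inv, add_comm]

/-- A matrix unit moves a nonzero row i of U to another row k; it squares to zero because k ≠ i. -/
theorem exists_mul_self_eq_zero_mul_ne_zero {R : Type*} [Ring R] [Nontrivial ι] {U : Matrix ι ι R} (hU : U ≠ 0) :
    ∃ N : Matrix ι ι R, N * N = 0 ∧ N * U ≠ 0 := by
  obtain ⟨i, j, hij⟩ : ∃ i j, U i j ≠ 0 := by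
    by_contra! h
    exact hU (Matrix.ext h)
  obtain ⟨k, hk⟩ := exists_ne i
  refine ⟨Matrix.single k i 1, Matrix.single_mul_single_of_ne _ _ _ _ hk.symm _, fun h => hij ?_⟩
  simpa using congrFun (congrFun h k) j

/-- The unipotent `1 + t N` for a square-zero matrix `N`. -/
def unipotent {N : Matrix ι ι F} (hN : N * N = 0) (t : F) : GL ι F where
  val := 1 + t • N
  inv := 1 - t • N
  val_inv := by simp [add_mul, mul_sub, hN]
  inv_val := by simp [sub_mul, mul_add, hN]

theorem card_mul_norm_matrixKloosterman_le_of_ne_zero_left [Nontrivial ι] {ψ : AddChar F ℂ}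
    (hψ : ψ.IsPrimitive) {U : Matrix ι ι F} (hU : U ≠ 0) (V : Matrix ι ι F) :
    Fintype.card F * ‖matrixKloosterman ψ U V‖ ≤ 5 * Fintype.card (Matrix ι ι F) := by
  obtain ⟨N, hN, hNU⟩ := exists_mul_self_eq_zero_mul_ne_zero hU
  have hq : (Fintype.card F : ℂ) ≠ 0 := Nat.cast_ne_zero.2 Fintype.card_ne_zero
  have h1 : ∀ t : F, matrixKloosterman ψ U V = ∑ X : GL ι F,
      ψ ((U * X.1).trace + (V * X⁻¹.1).trace)
        * ψ (t * ((X.1 * (N * U)).trace - ((V * N) * X⁻¹.1).trace)) := by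
    intro t
    unfold matrixKloosterman
    rw [← Equiv.sum_comp (Equiv.mulRight (unipotent hN t))]
    refine Finset.sum_congr rfl fun X _ => ?_
    rw [← AddChar.map_add_eq_mul]
    congr 1
    have e1 : (Equiv.mulRight (unipotent hN t) X).1 = X.1 * (1 + t • N) := rfl
    have e2 : (Equiv.mulRight (unipotent hN t) X)⁻¹.1 = (1 - t • N) * X⁻¹.1 := by
      rw [Equiv.coe_mulRight, _root_.mul_inv_rev]; rfl
    have e3 : (X.1 * (N * U)).trace = (U * (X.1 * N)).trace := by
      rw [← Matrix.mul_assoc, Matrix.trace_mul_comm]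
    rw [e1, e2, e3]
    simp only [mul_add, sub_mul, mul_sub, Matrix.mul_one, Matrix.one_mul, Matrix.trace_add,
      Matrix.trace_sub, Matrix.mul_smul, Matrix.smul_mul, Matrix.trace_smul, smul_eq_mul,
      Matrix.mul_assoc]
    ring
  -- Summing over t, orthogonality kills every X at which the coefficient of t is nonzero.
  have h2 : (Fintype.card F : ℂ) * matrixKloosterman ψ U V
      = Fintype.card F * ∑ X ∈ Finset.univ.filter fun X : GL ι F =>
          (X.1 * (N * U)).trace = ((V * N) * X⁻¹.1).trace,
        ψ ((U * X.1).trace + (V * X⁻¹.1).trace) := by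
    calc (Fintype.card F : ℂ) * matrixKloosterman ψ U V
        = ∑ _t : F, matrixKloosterman ψ U V := by simp
      _ = ∑ t : F, _ := Finset.sum_congr rfl fun t _ => h1 t
      _ = _ := by
        rw [Finset.sum_comm, Finset.sum_filter, Finset.mul_sum]
        refine Finset.sum_congr rfl fun X _ => ?_
        rw [← Finset.mul_sum, AddChar.sum_mulShift _ hψ]
        simp only [sub_eq_zero]
        split_ifs <;> simp [mul_comm]
  have h3 : ‖matrixKloosterman ψ U V‖ ≤ (Finset.univ.filter fun X : GL ι F =>
          (X.1 * (N * U)).trace = ((V * N) * X⁻¹.1).trace).card := by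
    rw [mul_left_cancel₀ hq h2]
    refine (norm_sum_le _ _).trans_eq ?_
    simp [AddChar.norm_apply]
  refine (mul_le_mul_of_nonneg_left h3 (Nat.cast_nonneg _)).trans ?_
  exact_mod_cast card_mul_card_trace_eq_le hNU (V * N)

theorem card_mul_norm_matrixKloosterman_le [Nontrivial ι] {ψ : AddChar F ℂ}
    (hψ : ψ.IsPrimitive) {U V : Matrix ι ι F} (h : (U, V) ≠ 0) :
    Fintype.card F * ‖matrixKloosterman ψ U V‖ ≤ 5 * Fintype.card (Matrix ι ι F) := by
  by_cases hU : U = 0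
  · rw [matrixKloosterman_comm]
    exact card_mul_norm_matrixKloosterman_le_of_ne_zero_left hψ
      (fun hV => h (Prod.ext hU hV)) U
  · exact card_mul_norm_matrixKloosterman_le_of_ne_zero_left hψ hU V

end Kloosterman

/-! ### Fourier expansion of the count and the error term. -/

section Fourier

variable {F ι : Type*} [Field F] [Fintype F] [DecidableEq F] [Fintype ι] [DecidableEq ι]

/-- The Fourier transform of the indicator function of a finite set of matrices. -/
noncomputable def fourierSum (ψ : AddChar F ℂ) (A : Finset (Matrix ι ι F)) (U : Matrix ι ι F) : ℂ :=
  ∑ a ∈ A, ψ (U * a).trace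

/-- Parseval: expand the square; only the diagonal a = b survives the sum over U. -/
theorem sum_norm_sq_fourierSum {ψ : AddChar F ℂ} (hψ : ψ ≠ 1) (A : Finset (Matrix ι ι F)) :
    ∑ U, ‖fourierSum ψ A U‖ ^ 2 = Fintype.card (Matrix ι ι F) * (A.card : ℝ) := by
  have h : ∀ U, ((‖fourierSum ψ A U‖ ^ 2 : ℝ) : ℂ)
      = ∑ a ∈ A, ∑ b ∈ A, ψ (U * (a - b)).trace := by
    intro U
    rw [Complex.ofReal_pow, ← Complex.mul_conj', fourierSum, map_sum, Finset.sum_mul_sum]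
    refine Finset.sum_congr rfl fun a _ => Finset.sum_congr rfl fun b _ => ?_
    rw [← AddChar.map_neg_eq_conj, ← AddChar.map_add_eq_mul, Matrix.mul_sub, Matrix.trace_sub,
      sub_eq_add_neg]
  rw [← Complex.ofReal_inj, Complex.ofReal_sum, Finset.sum_congr rfl fun U _ => h U,
    Finset.sum_comm]
  have h2 : ∀ a ∈ A, ∑ U : Matrix ι ι F, ∑ b ∈ A, ψ (U * (a - b)).trace
      = (Fintype.card (Matrix ι ι F) : ℂ) := by
    intro a ha
    rw [Finset.sum_comm, Finset.sum_congr rfl fun b _ => sum_addChar_trace_mul hψ (a - b)]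
    simp [sub_eq_zero, ha]
  rw [Finset.sum_congr rfl h2]
  simp [mul_comm]

theorem sum_norm_fourierSum_mul_le {ψ : AddChar F ℂ} (hψ : ψ ≠ 1) (A B : Finset (Matrix ι ι F)) :
    ∑ U, ‖fourierSum ψ A U‖ * ‖fourierSum ψ B U‖
      ≤ Fintype.card (Matrix ι ι F) * √((A.card : ℝ) * B.card) := by
  have h := Finset.sum_mul_sq_le_sq_mul_sq Finset.univ (fun U => ‖fourierSum ψ A U‖)
    fun U => ‖fourierSum ψ B U‖
  rw [sum_norm_sq_fourierSum hψ, sum_norm_sq_fourierSum hψ] at h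
  refine (Real.le_sqrt_of_sq_le h).trans_eq ?_
  rw [mul_mul_mul_comm, Real.sqrt_mul (by positivity), Real.sqrt_mul_self (by positivity)]

theorem card_mul_card_mul_count_eq {ψ : AddChar F ℂ} (hψ : ψ ≠ 1)
    (A B C D : Finset (Matrix ι ι F)) (H : GL ι F) :
    (Fintype.card (Matrix ι ι F) : ℂ) ^ 2
        * (((A ×ˢ B ×ˢ C ×ˢ D).filter
            (fun x => H.1 = (x.1 + x.2.1) * (x.2.2.1 + x.2.2.2))).card : ℂ)
      = ∑ U, ∑ V, (fourierSum ψ A U * fourierSum ψ B U) * (fourierSum ψ C V * fourierSum ψ D V)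
          * matrixKloosterman ψ (-U) (-(H.1 * V)) := by
  have hpt : ∀ P Q : Matrix ι ι F, (∑ X : GL ι F,
      (∑ U : Matrix ι ι F, ψ (U * (P - X.1)).trace)
        * ∑ V : Matrix ι ι F, ψ (V * (Q - X⁻¹.1 * H.1)).trace)
      = if H.1 = P * Q then (Fintype.card (Matrix ι ι F) : ℂ) ^ 2 else 0 := by
    intro P Q
    have hand : ∀ X : GL ι F, (∑ U : Matrix ι ι F, ψ (U * (P - X.1)).trace)
        * ∑ V : Matrix ι ι F, ψ (V * (Q - X⁻¹.1 * H.1)).trace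
        = if P = X.1 ∧ Q = X⁻¹.1 * H.1 then (Fintype.card (Matrix ι ι F) : ℂ) ^ 2 else 0 := by
      intro X
      simp only [sum_addChar_trace_mul hψ, sub_eq_zero, sq]
      split_ifs <;> simp_all
    rw [Finset.sum_congr rfl fun X _ => hand X]
    split_ifs with h
    -- P divides the invertible H, so exactly one X, namely P itself, contributes.
    · have hP : IsUnit P := by
        rw [Matrix.isUnit_iff_isUnit_det]
        have := (Matrix.isUnit_iff_isUnit_det _).1 H.isUnit
        rw [h, Matrix.det_mul] at this
        exact isUnit_of_mul_isUnit_left this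
      obtain ⟨Y, rfl⟩ := hP
      rw [Finset.sum_eq_single Y]
      · rw [if_pos]
        refine ⟨rfl, ?_⟩
        rw [h, ← Matrix.mul_assoc, Units.inv_mul, Matrix.one_mul]
      · intro X _ hX
        rw [if_neg]
        exact fun hh => hX (Units.ext hh.1.symm)
      · simp
    · refine Finset.sum_eq_zero fun X _ => if_neg fun hh => h ?_
      rw [hh.1, hh.2, ← Matrix.mul_assoc, Units.mul_inv, Matrix.one_mul]
  have hfac : ∀ U V : Matrix ι ι F,
      (fourierSum ψ A U * fourierSum ψ B U) * (fourierSum ψ C V * fourierSum ψ D V)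
      = ∑ x ∈ A ×ˢ B ×ˢ C ×ˢ D, ψ (U * x.1).trace * ψ (U * x.2.1).trace
          * (ψ (V * x.2.2.1).trace * ψ (V * x.2.2.2).trace) := by
    intro U V
    simp only [fourierSum, Finset.sum_product, ← Finset.mul_sum, ← Finset.sum_mul]
  have hterm : ∀ (x : Matrix ι ι F × Matrix ι ι F × Matrix ι ι F × Matrix ι ι F) (X : GL ι F)
      (U V : Matrix ι ι F),
      ψ (U * (x.1 + x.2.1 - X.1)).trace * ψ (V * (x.2.2.1 + x.2.2.2 - X⁻¹.1 * H.1)).trace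
      = ψ (U * x.1).trace * ψ (U * x.2.1).trace * (ψ (V * x.2.2.1).trace * ψ (V * x.2.2.2).trace)
        * ψ ((-U * X.1).trace + (-(H.1 * V) * X⁻¹.1).trace) := by
    intro x X U V
    have e : (H.1 * V * X⁻¹.1).trace = (V * (X⁻¹.1 * H.1)).trace := by
      rw [Matrix.mul_assoc, Matrix.trace_mul_comm, Matrix.mul_assoc]
    simp only [← AddChar.map_add_eq_mul]
    congr 1
    simp only [Matrix.mul_add, Matrix.mul_sub, Matrix.neg_mul, Matrix.trace_add, Matrix.trace_sub,
      Matrix.trace_neg, e]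
    ring
  calc _ = ∑ x ∈ A ×ˢ B ×ˢ C ×ˢ D, ∑ X : GL ι F, ∑ U : Matrix ι ι F, ∑ V : Matrix ι ι F,
        ψ (U * (x.1 + x.2.1 - X.1)).trace
          * ψ (V * (x.2.2.1 + x.2.2.2 - X⁻¹.1 * H.1)).trace := by
        simp_rw [← Finset.sum_mul_sum, hpt]
        rw [← Finset.sum_filter, Finset.sum_const, nsmul_eq_mul, mul_comm]
    _ = ∑ U : Matrix ι ι F, ∑ V : Matrix ι ι F, ∑ X : GL ι F, ∑ x ∈ A ×ˢ B ×ˢ C ×ˢ D,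
        ψ (U * (x.1 + x.2.1 - X.1)).trace
          * ψ (V * (x.2.2.1 + x.2.2.2 - X⁻¹.1 * H.1)).trace := by
        rw [Finset.sum_comm, Finset.sum_congr rfl fun X _ => Finset.sum_comm, Finset.sum_comm]
        refine Finset.sum_congr rfl fun U _ => ?_
        rw [Finset.sum_congr rfl fun X _ => Finset.sum_comm, Finset.sum_comm]
    _ = _ := by
        refine Finset.sum_congr rfl fun U _ => Finset.sum_congr rfl fun V _ => ?_
        rw [hfac, matrixKloosterman, Finset.mul_sum]
        refine Finset.sum_congr rfl fun X _ => ?_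
        rw [Finset.sum_mul]
        exact Finset.sum_congr rfl fun x _ => hterm x X U V

theorem matrixKloosterman_zero_zero (ψ : AddChar F ℂ) :
    matrixKloosterman ψ (0 : Matrix ι ι F) 0 = Fintype.card (GL ι F) := by
  simp [matrixKloosterman]

/-- Replacing #GL by Q at the origin makes the main term exact. The cost is the number of singular
matrices, so one bound serves all frequencies. -/
theorem card_mul_norm_matrixKloosterman_sub_le [Nontrivial ι] {ψ : AddChar F ℂ}
    (hψ : ψ.IsPrimitive) (U V : Matrix ι ι F) :
    Fintype.card F * ‖matrixKloosterman ψ U V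
        - if (U, V) = 0 then (Fintype.card (Matrix ι ι F) : ℂ) else 0‖
      ≤ (Fintype.card ι + 5) * Fintype.card (Matrix ι ι F) := by
  split_ifs with h
  · obtain ⟨rfl, rfl⟩ : U = 0 ∧ V = 0 := by simpa using h
    have h1 := card_GL_add_card_det_eq_zero (F := F) (ι := ι)
    have h2 := card_mul_card_det_eq_zero_le (F := F) (ι := ι)
    rw [matrixKloosterman_zero_zero, ← h1, Nat.cast_add, sub_add_cancel_left, norm_neg,
      Complex.norm_natCast, h1]
    have h3 : (Fintype.card F : ℝ) * (Finset.univ.filter fun X : Matrix ι ι F => X.det = 0).card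
      ≤ Fintype.card ι * Fintype.card (Matrix ι ι F) := by exact_mod_cast h2
    refine h3.trans ?_
    gcongr
    linarith
  · rw [sub_zero]
    refine (card_mul_norm_matrixKloosterman_le hψ h).trans ?_
    gcongr
    linarith [(Nat.cast_nonneg (Fintype.card ι) : (0 : ℝ) ≤ _)]

/-- The error term, with a saving of a full factor `#F`. -/
theorem card_mul_abs_count_sub_le [Nontrivial ι]
    (A B C D : Finset (Matrix ι ι F)) (H : GL ι F) :
    (Fintype.card F : ℝ) * |(((A ×ˢ B ×ˢ C ×ˢ D).filter
            (fun x => H.1 = (x.1 + x.2.1) * (x.2.2.1 + x.2.2.2))).card : ℝ)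
        - (A.card : ℝ) * B.card * C.card * D.card / Fintype.card (Matrix ι ι F)|
      ≤ (Fintype.card ι + 5) * Fintype.card (Matrix ι ι F)
        * √((A.card : ℝ) * B.card * C.card * D.card) := by
  have hψ := AddChar.FiniteField.primitiveChar_to_Complex_isPrimitive F
  set ψ := AddChar.FiniteField.primitiveChar_to_Complex F
  have hψ1 : ψ ≠ 1 := by
    simpa using hψ one_ne_zero
  set Q := Fintype.card (Matrix ι ι F) with hQ
  have hQ0 : (0 : ℝ) < Q := Nat.cast_pos.2 Fintype.card_pos
  set R := ((A ×ˢ B ×ˢ C ×ˢ D).filter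
            (fun x => H.1 = (x.1 + x.2.1) * (x.2.2.1 + x.2.2.2))).card
  set k : ℝ := Fintype.card ι + 5
  let δ : Matrix ι ι F → Matrix ι ι F → ℂ := fun U V => matrixKloosterman ψ (-U) (-(H.1 * V))
        - if (-U, -(H.1 * V)) = 0 then (Q : ℂ) else 0
  have hδ : ∀ U V, Fintype.card F * ‖δ U V‖ ≤ k * Q := fun U V =>
    card_mul_norm_matrixKloosterman_sub_le hψ _ _
  have hmain : (Q : ℂ) ^ 2 * (R - (A.card : ℂ) * B.card * C.card * D.card / Q)
      = ∑ U, ∑ V, (fourierSum ψ A U * fourierSum ψ B U) * (fourierSum ψ C V * fourierSum ψ D V)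
          * δ U V := by
    -- As H is invertible, the origin is the only frequency with a main term.
    have hiff : ∀ U V : Matrix ι ι F, (-U, -(H.1 * V)) = 0 ↔ U = 0 ∧ V = 0 := fun U V => by
      rw [Prod.mk_eq_zero, neg_eq_zero, neg_eq_zero, Units.mul_right_eq_zero]
    have hzero : ∑ U, ∑ V, (fourierSum ψ A U * fourierSum ψ B U)
          * (fourierSum ψ C V * fourierSum ψ D V) * (if (-U, -(H.1 * V)) = 0 then (Q : ℂ) else 0)
        = A.card * B.card * (C.card * D.card) * Q := by
      simp_rw [hiff, ite_and]
      simp [fourierSum]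
    have hQc : (Q : ℂ) ≠ 0 := by exact_mod_cast hQ0.ne'
    simp only [δ, mul_sub, Finset.sum_sub_distrib]
    rw [hzero, ← card_mul_card_mul_count_eq hψ1, ← hQ]
    field_simp
    ring
  have hbound : (Fintype.card F : ℝ) * ‖(Q : ℂ) ^ 2
        * (R - (A.card : ℂ) * B.card * C.card * D.card / Q)‖
      ≤ k * Q * ((Q * √((A.card : ℝ) * B.card)) * (Q * √((C.card : ℝ) * D.card))) := by
    rw [hmain]
    calc (Fintype.card F : ℝ) * ‖_‖
        ≤ Fintype.card F * ∑ U, ∑ V, ‖(fourierSum ψ A U * fourierSum ψ B U)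
            * (fourierSum ψ C V * fourierSum ψ D V) * δ U V‖ := by
          gcongr
          exact (norm_sum_le _ _).trans (Finset.sum_le_sum fun U _ => norm_sum_le _ _)
      _ = ∑ U, ∑ V, (‖fourierSum ψ A U‖ * ‖fourierSum ψ B U‖)
            * (‖fourierSum ψ C V‖ * ‖fourierSum ψ D V‖) * (Fintype.card F * ‖δ U V‖) := by
          simp only [Finset.mul_sum, norm_mul]
          refine Finset.sum_congr rfl fun U _ => Finset.sum_congr rfl fun V _ => ?_
          ring
      _ ≤ ∑ U, ∑ V, (‖fourierSum ψ A U‖ * ‖fourierSum ψ B U‖)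
            * (‖fourierSum ψ C V‖ * ‖fourierSum ψ D V‖) * (k * Q) := by
          exact Finset.sum_le_sum fun U _ => Finset.sum_le_sum fun V _ =>
            mul_le_mul_of_nonneg_left (hδ U V) (by positivity)
      _ = k * Q * ((∑ U, ‖fourierSum ψ A U‖ * ‖fourierSum ψ B U‖)
            * ∑ V, ‖fourierSum ψ C V‖ * ‖fourierSum ψ D V‖) := by
          rw [Finset.sum_mul_sum, mul_comm (k * (Q : ℝ))]
          simp only [Finset.sum_mul]
      _ ≤ _ := by
          gcongr
          · exact sum_norm_fourierSum_mul_le hψ1 A B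
          · exact sum_norm_fourierSum_mul_le hψ1 C D
  have hcast : ‖(Q : ℂ) ^ 2 * (R - (A.card : ℂ) * B.card * C.card * D.card / Q)‖
      = (Q : ℝ) ^ 2 * |(R : ℝ) - (A.card : ℝ) * B.card * C.card * D.card / Q| := by
    rw [norm_mul, norm_pow, Complex.norm_natCast, ← Real.norm_eq_abs, ← Complex.norm_real]
    push_cast
    rfl
  rw [hcast] at hbound
  have hsqrt : √((A.card : ℝ) * B.card * C.card * D.card)
      = √((A.card : ℝ) * B.card) * √((C.card : ℝ) * D.card) := by
    rw [← Real.sqrt_mul (by positivity), mul_assoc ((A.card : ℝ) * B.card)]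
  rw [hsqrt]
  refine le_of_mul_le_mul_left ?_ (pow_pos hQ0 2)
  linarith

end Fourier

end

/-! ### The stated estimate and solvability. -/

/-- The asymptotic formula for `sumProdCount` with the saving `q ^ (1 / 2)`. -/
theorem abs_sumProdCount_sub_le {n : ℕ} (hn : 2 ≤ n) {F : Type*} [Field F] [Fintype F] [DecidableEq F]
    (A B C D : Finset (Matrix (Fin n) (Fin n) F)) (H : Matrix.GeneralLinearGroup (Fin n) F) :
    |(sumProdCount A B C D (H : Matrix (Fin n) (Fin n) F) : ℝ)
        - ((A.card : ℝ) * (B.card : ℝ) * (C.card : ℝ) * (D.card : ℝ))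
            / (Fintype.card F : ℝ) ^ (n ^ 2)|
      ≤ (n + 5) * ((Fintype.card F : ℝ) ^ ((n : ℝ) ^ 2 - 1 / 2)
          * Real.sqrt ((A.card : ℝ) * (B.card : ℝ) * (C.card : ℝ) * (D.card : ℝ))) := by
  have : Nontrivial (Fin n) := Fin.nontrivial_iff_two_le.2 hn
  have h := card_mul_abs_count_sub_le A B C D H
  have hq1 : (1 : ℝ) ≤ Fintype.card F := Nat.one_le_cast.2 Fintype.card_pos
  have hq0 : (0 : ℝ) < Fintype.card F := zero_lt_one.trans_le hq1
  have hQ : (Fintype.card (Matrix (Fin n) (Fin n) F) : ℝ) = (Fintype.card F : ℝ) ^ (n ^ 2) := by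
    rw [← Nat.card_eq_fintype_card]
    simp [Matrix, ← pow_mul, sq]
  rw [hQ, Fintype.card_fin] at h
  change _ * |(sumProdCount A B C D H.1 : ℝ) - _| ≤ _ at h
  -- The saving of a full factor q is weakened here to q^(1/2).
  have hpow : (Fintype.card F : ℝ) ^ (n ^ 2)
      ≤ Fintype.card F * (Fintype.card F : ℝ) ^ ((n : ℝ) ^ 2 - 1 / 2) := by
    rw [← Real.rpow_one_add' hq0.le (by
      have : (2 : ℝ) ≤ n := by exact_mod_cast hn
      nlinarith), ← Real.rpow_natCast]
    refine Real.rpow_le_rpow_of_exponent_le hq1 ?_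
    push_cast
    linarith
  refine le_of_mul_le_mul_left (h.trans ?_) hq0
  calc _ ≤ (n + 5) * (Fintype.card F * (Fintype.card F : ℝ) ^ ((n : ℝ) ^ 2 - 1 / 2))
        * √((A.card : ℝ) * B.card * C.card * D.card) := by gcongr
    _ = _ := by ring

theorem exists_of_sumProdCount_pos {n : ℕ} {F : Type*} [Field F] [DecidableEq F]
    {A B C D : Finset (Matrix (Fin n) (Fin n) F)} {H : Matrix (Fin n) (Fin n) F}
    (h : 0 < sumProdCount A B C D H) :
    ∃ a ∈ A, ∃ b ∈ B, ∃ c ∈ C, ∃ d ∈ D, H = (a + b) * (c + d) := by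
  obtain ⟨⟨a, b, c, d⟩, hx⟩ := Finset.card_pos.1 h
  simp only [Finset.mem_filter, Finset.mem_product] at hx
  exact ⟨a, hx.1.1, b, hx.1.2.1, c, hx.1.2.2.1, d, hx.1.2.2.2, hx.2⟩

theorem theorem8 (n : ℕ) (hn : 2 ≤ n) :
    (∃ K : ℝ, 0 < K ∧
      ∀ (F : Type*) [Field F] [Fintype F] [DecidableEq F]
        (A B C D : Finset (Matrix (Fin n) (Fin n) F))
        (H : Matrix.GeneralLinearGroup (Fin n) F),
        |(sumProdCount A B C D (H : Matrix (Fin n) (Fin n) F) : ℝ)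
            - ((A.card : ℝ) * (B.card : ℝ) * (C.card : ℝ) * (D.card : ℝ))
                / (Fintype.card F : ℝ) ^ (n ^ 2)|
          ≤ K * ((Fintype.card F : ℝ) ^ ((n : ℝ) ^ 2 - 1 / 2)
              * Real.sqrt ((A.card : ℝ) * (B.card : ℝ) * (C.card : ℝ) * (D.card : ℝ)))) ∧
    (∃ c : ℝ, 0 < c ∧
      ∀ (F : Type*) [Field F] [Fintype F] [DecidableEq F]
        (A B C D : Finset (Matrix (Fin n) (Fin n) F)),
        c * (Fintype.card F : ℝ) ^ (4 * (n : ℝ) ^ 2 - 1)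
            ≤ (A.card : ℝ) * (B.card : ℝ) * (C.card : ℝ) * (D.card : ℝ) →
        ∀ H : Matrix.GeneralLinearGroup (Fin n) F,
          ∃ a ∈ A, ∃ b ∈ B, ∃ c' ∈ C, ∃ d ∈ D,
            (H : Matrix (Fin n) (Fin n) F) = (a + b) * (c' + d)) := by
  refine ⟨⟨n + 5, by positivity, fun F _ _ _ A B C D H => abs_sumProdCount_sub_le hn A B C D H⟩,
    -- With no solutions, the main term is at most the error, which forces the product of the
    -- cardinalities to be at most (n+5)² q^(4n²-1); the extra 1 makes this contradictory.
    ⟨(n + 5) ^ 2 + 1, by positivity, fun F _ _ _ A B C D hcard H => exists_of_sumProdCount_pos ?_⟩⟩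
  have h := abs_sumProdCount_sub_le hn A B C D H
  have hq0 : (0 : ℝ) < Fintype.card F := Nat.cast_pos.2 Fintype.card_pos
  by_contra hpos
  rw [Nat.eq_zero_of_not_pos hpos, Nat.cast_zero, zero_sub, abs_neg, abs_of_nonneg (by positivity)] at h
  set S := (A.card : ℝ) * B.card * C.card * D.card
  set q := (Fintype.card F : ℝ)
  have hS : 0 < S := lt_of_lt_of_le (by positivity) hcard
  have hexp : q ^ (n ^ 2) * q ^ ((n : ℝ) ^ 2 - 1 / 2) = q ^ (2 * (n : ℝ) ^ 2 - 1 / 2) := by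
    rw [← Real.rpow_natCast, ← Real.rpow_add hq0]
    push_cast
    ring_nf
  have hexp2 : (q ^ (2 * (n : ℝ) ^ 2 - 1 / 2)) ^ 2 = q ^ (4 * (n : ℝ) ^ 2 - 1) := by
    rw [← Real.rpow_mul_natCast hq0.le]
    push_cast
    ring_nf
  rw [div_le_iff₀ (by positivity)] at h
  have h1 : √S * √S ≤ ((n + 5) * q ^ (2 * (n : ℝ) ^ 2 - 1 / 2)) * √S := by
    rw [Real.mul_self_sqrt hS.le, ← hexp]
    linarith
  have h2 := le_of_mul_le_mul_right h1 (Real.sqrt_pos.2 hS)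
  have h3 := (Real.sqrt_le_left (by positivity)).1 h2
  rw [mul_pow, hexp2] at h3
  have h4 : 0 < q ^ (4 * (n : ℝ) ^ 2 - 1) := by positivity
  linarith
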